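/- Let $\Xi$ be a measurable space with a $\sigma$-finite dominating measure $d\xi$ (for instance $\Xi\subseteq\mathbb R^D$ with Lebesgue measure). Let $h:\Xi\to[0,\infty)$ (not almost everywhere $0$) and $s:\Xi\to\mathbb R^K$ be measurable, put $A(\eta)=\ln\int_\Xi h(\xi)\,e^{\eta^\top s(\xi)}\,d\xi\in(-\infty,\infty]$ and $\Omega=\{\eta\in\mathbb R^K: A(\eta)<\infty\}$, and for $\eta\in\Omega$ let $\mathbb P_\eta$ be the probability measure with density $p(\xi\mid\eta)=h(\xi)\exp(\eta^\top s(\xi)-A(\eta))$. For $(\tau,\nu)\in\mathbb R^K\times\mathbb R$ let $Z(\tau,\nu)=\int_\Omega\exp(\tau^\top\eta-\nu A(\eta))\,d\eta$, and, when $0<Z(\tau,\nu)<\infty$, let $\Pi(\eta\mid\tau,\nu)=Z(\tau,\nu)^{-1}\exp(\tau^\top\eta-\nu A(\eta))$ be the conjugate density on $\Omega$. Let $T$ be a set of hyperparameters $(\tau,\nu)$ with $0<Z(\tau,\nu)<\infty$ such that for almost every $\eta\in\Omega$ the partial derivatives of $\Pi(\eta\mid\tau,\nu)$ with respect to $\nu$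 and to the coordinates of $\tau$ exist at every $(\tau,\nu)\in T$ (so that in particular $Z$ is finite near $(\tau,\nu)$ along each coordinate direction). Given prior hyperparameters $(\tau_0,\nu_0)$ and data $\xi_1,\dots,\xi_n\in\Xi$, suppose that the posterior hyperparameters $\tau=\tau_0+\sum_{i=1}^n s(\xi_i)$ and $\nu=\nu_0+n$ satisfy $(\tau,\nu)\in T$, and let $\Pi=\Pi(\cdot\mid\tau,\nu)$ be the posterior, $\hat\eta=\mathbb E_{\eta\sim\Pi}[\eta]$ its mean and $G(\tau,\nu)=\mathbb E_{\eta\sim\Pi}[A(\eta)]-A(\hat\eta)$. Let $f_x:\Xi\to\mathbb R$, $x\in\mathcal X$, be measurable, let $\epsilon\in[0,\infty)$ satisfy $\epsilon\ge\epsilon_{\min}(n):=G(\tau,\nu)$, and assume that for every $x\in\mathcal X$ there is $t>0$ with $\mathbb E_{\xi\sim p(\xi\mid\hat\eta)}[e^{t f_x(\xi)}]<\infty$. Then $\eta$ and $A(\eta)$ are $\Pi$-integrable, $\hat\eta\in\Omega$, and, for every $x\in\mathcal X$, $$\sup_{\mathbb Q\in\mathcal A_\epsilon(\Pi)}\mathbb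 E_{\xi\sim\mathbb Q}[f_x(\xi)]=\inf_{\gamma\ge 0}\;\gamma\,(\epsilon-G(\tau,\nu))+\gamma\ln\mathbb E_{\xi\sim p(\xi\mid\hat\eta)}\!\left[e^{f_x(\xi)/\gamma}\right],$$ where $\mathcal A_\epsilon(\Pi)$ is the set of all probability measures $\mathbb Q$ on $\Xi$ with $\mathbb Q\ll\mathbb P_\eta$ for all $\eta\in\Omega$ and $\mathbb E_{\eta\sim\Pi}[d_{\mathrm{KL}}(\mathbb Q\,\|\,\mathbb P_\eta)]\le\epsilon$. Both sides are taken in $[-\infty,\infty]$; the second term on the right is $+\infty$ when its expectation is infinite, and at $\gamma=0$ it means its limit as $\gamma\downarrow0$, the essential supremum of $f_x$ under $p(\xi\mid\hat\eta)$. -/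

import Mathlib

open MeasureTheory InformationTheory
open scoped ENNReal NNReal

noncomputable section

/-- The extended expectation `E_Q[g] = E_Q[g⁺] - E_Q[g⁻] ∈ [-∞, ∞]`. When both parts are infinite
(the expectation does not exist) the value is `⊤ - ⊤ = ⊥`, so that such a `Q` does not contribute
to a supremum. -/
def extExpectation {Ξ : Type*} [MeasurableSpace Ξ] (Q : Measure Ξ) (g : Ξ → ℝ) : EReal :=
  ((∫⁻ ξ, ENNReal.ofReal (g ξ) ∂Q : ℝ≥0∞) : EReal)
    - ((∫⁻ ξ, ENNReal.ofReal (-g ξ) ∂Q : ℝ≥0∞) : EReal)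

/-- The worst-case risk `sup_{Q ∈ 𝒜} E_Q[g]` over a set `𝒜` of probability measures. -/
def worstCaseRisk {Ξ : Type*} [MeasurableSpace Ξ] (𝒜 : Set (ProbabilityMeasure Ξ))
    (g : Ξ → ℝ) : EReal :=
  ⨆ Q ∈ 𝒜, extExpectation (Q : Measure Ξ) g

/-- The Bayesian ambiguity set via posterior expectation: all probability measures `Q` with
`Q ≪ P θ` for every parameter `θ ∈ Θ`, and `E_{θ ∼ Post}[KL(Q ‖ P θ)] ≤ ε`. -/
def basPE {Ξ E : Type*} [MeasurableSpace Ξ] [MeasurableSpace E] (Θ : Set E)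
    (P : E → Measure Ξ) (Post : Measure E) (ε : ℝ≥0) : Set (ProbabilityMeasure Ξ) :=
  {Q | (∀ θ ∈ Θ, (Q : Measure Ξ) ≪ P θ) ∧
    ∫⁻ θ, klDiv (Q : Measure Ξ) (P θ) ∂Post ≤ (ε : ℝ≥0∞)}

/-- Finite moment-generating function of the objectives `f x` under `P`: for every decision `x`
there is `t > 0` with `E_P[exp (t f x)] < ∞`. -/
def FiniteMGF {Ξ X : Type*} [MeasurableSpace Ξ] (P : Measure Ξ) (f : X → Ξ → ℝ) : Prop :=
  ∀ x, ∃ t : ℝ, 0 < t ∧ ∫⁻ ξ, ENNReal.ofReal (Real.exp (t * f x ξ)) ∂P < ∞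

/-- `γ ln E_P[exp (g / γ)]` with values in `[-∞, ∞]`; it is `∞` where the expectation is infinite.
At `γ = 0` it has its usual meaning, the limit as `γ ↓ 0`, that is the essential supremum
of `g` under `P`. -/
def scaledLogMGF {Ξ : Type*} [MeasurableSpace Ξ] (P : Measure Ξ) (g : Ξ → ℝ) (γ : ℝ≥0) : EReal :=
  if γ = 0 then essSup (fun ξ => (g ξ : EReal)) P
  else ((γ : ℝ) : EReal) *
    ENNReal.log (∫⁻ ξ, ENNReal.ofReal (Real.exp (g ξ / (γ : ℝ))) ∂P)

/-- The data of an exponential family on `Ξ` with natural parameter in `ℝ^K`: the dominating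
measure `base` with respect to which densities are taken, the scaling `h` and the sufficient
statistic `s`. The last field says that `h` is not almost everywhere zero, so that the
log-partition function never takes the value `-∞`. -/
structure ExpFamily (Ξ : Type*) [MeasurableSpace Ξ] (K : ℕ) where
  base : Measure Ξ
  sigmaFinite_base : SigmaFinite base
  h : Ξ → ℝ
  measurable_h : Measurable h
  h_nonneg : ∀ ξ, 0 ≤ h ξ
  s : Ξ → EuclideanSpace ℝ (Fin K)
  measurable_s : Measurable s
  h_ne_zero : ¬ (h =ᵐ[base] 0)

namespace ExpFamily

variable {Ξ : Type*} [MeasurableSpace Ξ] {K : ℕ} (M : ExpFamily Ξ K)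

/-- `∫ h(ξ) exp(ηᵀ s(ξ)) dξ ∈ (0, ∞]`. -/
def partition (η : EuclideanSpace ℝ (Fin K)) : ℝ≥0∞ :=
  ∫⁻ ξ, ENNReal.ofReal (M.h ξ * Real.exp (inner ℝ η (M.s ξ))) ∂M.base

/-- The natural parameter space `Ω`, where the log-partition function is finite. -/
def natParam : Set (EuclideanSpace ℝ (Fin K)) := {η | M.partition η < ∞}

/-- The log-partition function `A`, meaningful on `Ω`. -/
def logPartition (η : EuclideanSpace ℝ (Fin K)) : ℝ := Real.log (M.partition η).toReal

/-- The likelihood `P_η`, with density `h(ξ) exp(ηᵀ s(ξ) - A(η))` for `η ∈ Ω`. -/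
def likelihood (η : EuclideanSpace ℝ (Fin K)) : Measure Ξ :=
  M.base.withDensity fun ξ =>
    ENNReal.ofReal (M.h ξ * Real.exp (inner ℝ η (M.s ξ) - M.logPartition η))

/-- The normalising constant `Z(τ, ν) = ∫_Ω exp(τᵀη - ν A(η)) dη ∈ [0, ∞]` of the conjugate
family. -/
def conjZ (τ : EuclideanSpace ℝ (Fin K)) (ν : ℝ) : ℝ≥0∞ :=
  ∫⁻ η in M.natParam, ENNReal.ofReal (Real.exp (inner ℝ τ η - ν * M.logPartition η))

/-- The hyperparameters `(τ, ν)` for which the conjugate density can be normalised. -/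
def properHyper : Set (EuclideanSpace ℝ (Fin K) × ℝ) :=
  {p | M.conjZ p.1 p.2 ≠ 0 ∧ M.conjZ p.1 p.2 ≠ ∞}

/-- The conjugate density `Z(τ, ν)⁻¹ exp(τᵀη - ν A(η))`. It is `0` where `Z(τ, ν) = ∞`, so it can
be differentiable in a hyperparameter only if `Z` stays finite nearby. -/
def conjPDF (τ : EuclideanSpace ℝ (Fin K)) (ν : ℝ) (η : EuclideanSpace ℝ (Fin K)) : ℝ :=
  Real.exp (inner ℝ τ η - ν * M.logPartition η) / (M.conjZ τ ν).toReal

/-- The conjugate distribution on `Ω` with hyperparameters `(τ, ν)` (prior or posterior). -/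
def conj (τ : EuclideanSpace ℝ (Fin K)) (ν : ℝ) : Measure (EuclideanSpace ℝ (Fin K)) :=
  (volume.restrict M.natParam).withDensity fun η => ENNReal.ofReal (M.conjPDF τ ν η)

/-- At `η`, the conjugate density has a partial derivative in `ν` and partial derivatives in all
coordinates of `τ` at the hyperparameter `(τ, ν)`. -/
def HasHyperPartials (τ : EuclideanSpace ℝ (Fin K)) (ν : ℝ)
    (η : EuclideanSpace ℝ (Fin K)) : Prop :=
  DifferentiableAt ℝ (fun ν' => M.conjPDF τ ν' η) ν ∧
    ∀ i, LineDifferentiableAt ℝ (fun τ' => M.conjPDF τ' ν η) τ (EuclideanSpace.single i 1)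

/-- The mean `η̂` of the natural parameter under the conjugate distribution. -/
def etaHat (τ : EuclideanSpace ℝ (Fin K)) (ν : ℝ) : EuclideanSpace ℝ (Fin K) :=
  ∫ η, η ∂(M.conj τ ν)

/-- `G(τ, ν) = E[A(η)] - A(η̂)`, the expectation being under the conjugate distribution. -/
def gap (τ : EuclideanSpace ℝ (Fin K)) (ν : ℝ) : ℝ :=
  ∫ η, M.logPartition η ∂(M.conj τ ν) - M.logPartition (M.etaHat τ ν)

end ExpFamily

end

/-! The log-likelihood ratio of `P_η` to `P_η̂` is `L_η(ξ) = ⟨η - η̂, s(ξ)⟩ - A(η) + A(η̂)`. Its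
linear part has posterior mean zero, so its posterior mean is `-G` for every `ξ`. Hence `E[KL(Q ‖
P_η)] = KL(Q ‖ P_η̂) + G`, and the ambiguity set is the Kullback-Leibler ball of radius `r = ε - G`
around `P_η̂` (`basPE_eq_klBall`). The identity is proved by Tonelli on a nonnegative integrand, so
`s` need not be `Q`-integrable and divergences may be infinite.

Integrability of `η` and `A` comes from differentiability in the hyperparameters: it keeps `Z`
finite on both sides of `(τ, ν)`, and ratios of values of `Z` are exponential moments of the
posterior. Jensen then gives `η̂ ∈ Ω` and `G ≥ 0`.

Duality over the ball (`worstCaseRisk_klBall`): `≤` is the Gibbs variational inequality. For `r >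
0`, the attainable pairs (divergence, expectation) form a convex set; a supporting line at abscissa
`r` has slope `γ`, and testing it on Gibbs densities truncated to `{|g| ≤ m}` recovers `γ ln E[exp
(g / γ)]`. For `r = 0` there may be no such line; instead `γ → ∞`, and the finite exponential moment
yields the limit `E[g]`. -/

/-! ### Supporting lines of planar convex sets -/

section Supergradient

/-- A convex set in the plane that lies below height `V` to the left of `r` lies below a line
through `(r, V)`, provided it has a point strictly to the left of `r`. -/
theorem exists_nonneg_slope_of_convex {S : Set (ℝ × ℝ)} (hS : Convex ℝ S) {r V : ℝ}
    (hle : ∀ p ∈ S, p.1 ≤ r → p.2 ≤ V) (hne : ∃ p ∈ S, p.1 < r) :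
    ∃ γ : ℝ, 0 ≤ γ ∧ ∀ p ∈ S, p.2 ≤ V + γ * (p.1 - r) := by
  have key : ∀ p ∈ S, ∀ p' ∈ S, p.1 < r → r < p'.1 →
      (p'.2 - V) / (p'.1 - r) ≤ (V - p.2) / (r - p.1) := by
    intro p hp p' hp' h1 h2
    have hd : 0 < p'.1 - p.1 := by linarith
    -- These weights place the point of the chord exactly at abscissa `r`, where its height is at
    -- most `V`.
    have hmem := hS hp hp' (a := (p'.1 - r) / (p'.1 - p.1)) (b := (r - p.1) / (p'.1 - p.1))
      (div_nonneg (by linarith) hd.le) (div_nonneg (by linarith) hd.le)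
      (by field_simp; ring)
    have h := hle _ hmem (le_of_eq (by simp; field_simp; ring))
    simp only [Prod.snd_add, Prod.smul_snd, smul_eq_mul] at h
    rw [div_mul_eq_mul_div, div_mul_eq_mul_div, ← add_div, div_le_iff₀ hd] at h
    rw [div_le_div_iff₀ (by linarith) (by linarith)]
    nlinarith
  obtain ⟨p₀, hp₀, hlt₀⟩ := hne
  -- The slope is the supremum of the slopes from `(r, V)` to points on the right. Inserting `0`
  -- makes it nonnegative, and covers the case of no such point.
  set D : Set ℝ := insert 0 ((fun p : ℝ × ℝ => (p.2 - V) / (p.1 - r)) '' {p ∈ S | r < p.1})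
    with hD
  have hbd : ∀ p ∈ S, p.1 < r → ∀ d ∈ D, d ≤ (V - p.2) / (r - p.1) := by
    rintro p hp hpr d (rfl | ⟨p', ⟨hp', hr'⟩, rfl⟩)
    · exact div_nonneg (by linarith [hle p hp hpr.le]) (by linarith)
    · exact key p hp p' hp' hpr hr'
  have hbdd : BddAbove D := ⟨_, hbd p₀ hp₀ hlt₀⟩
  refine ⟨sSup D, le_csSup hbdd (Set.mem_insert _ _), fun p hp => ?_⟩
  rcases lt_trichotomy p.1 r with h | h | h
  · have := csSup_le (Set.insert_nonempty _ _) (hbd p hp h)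
    rw [le_div_iff₀ (by linarith)] at this
    linarith
  · have := hle p hp h.le
    rw [h]; linarith
  · have : (p.2 - V) / (p.1 - r) ≤ sSup D :=
      le_csSup hbdd (Set.mem_insert_of_mem _ ⟨p, ⟨hp, h⟩, rfl⟩)
    rw [div_le_iff₀ (by linarith)] at this
    linarith

end Supergradient

/-! ### Weak duality over a Kullback-Leibler ball -/

section KLBall

variable {Ξ : Type*} [MeasurableSpace Ξ]

theorem extExpectation_of_integrable {Q : Measure Ξ} {g : Ξ → ℝ} (hg : Integrable g Q) :
    extExpectation Q g = ((∫ ξ, g ξ ∂Q : ℝ) : EReal) := by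
  have h1 : ∫⁻ ξ, ENNReal.ofReal (g ξ) ∂Q ≠ ∞ := hg.lintegral_lt_top.ne
  have h2 : ∫⁻ ξ, ENNReal.ofReal (-g ξ) ∂Q ≠ ∞ := hg.neg.lintegral_lt_top.ne
  rw [integral_eq_lintegral_pos_part_sub_lintegral_neg_part hg, EReal.coe_sub,
    EReal.coe_ennreal_toReal h1, EReal.coe_ennreal_toReal h2, extExpectation]

/-- An infinite negative part makes the extended expectation `⊥`, so only the integrable case needs
an argument. -/
theorem extExpectation_le_of_integrable {Q : Measure Ξ} {g : Ξ → ℝ}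
    (hgm : AEStronglyMeasurable g Q) (hpos : ∫⁻ ξ, ENNReal.ofReal (g ξ) ∂Q ≠ ∞) {c : EReal}
    (h : Integrable g Q → ((∫ ξ, g ξ ∂Q : ℝ) : EReal) ≤ c) : extExpectation Q g ≤ c := by
  by_cases hneg : ∫⁻ ξ, ENNReal.ofReal (-g ξ) ∂Q = ∞
  · simp [extExpectation, hneg]
  · have hi : Integrable g Q := by
      refine ⟨hgm, ?_⟩
      rw [hasFiniteIntegral_iff_norm]
      calc ∫⁻ ξ, ENNReal.ofReal ‖g ξ‖ ∂Q
          ≤ ∫⁻ ξ, (ENNReal.ofReal (g ξ) + ENNReal.ofReal (-g ξ)) ∂Q := by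
            refine lintegral_mono fun ξ => ?_
            rcases le_total 0 (g ξ) with h0 | h0
            · rw [Real.norm_of_nonneg h0]; exact le_self_add
            · rw [Real.norm_of_nonpos h0]; exact le_add_self
        _ = _ := lintegral_add_left' hgm.aemeasurable.ennreal_ofReal _
        _ < ∞ := ENNReal.add_lt_top.2 ⟨hpos.lt_top, lt_top_iff_ne_top.2 hneg⟩
    rw [extExpectation_of_integrable hi]
    exact h hi

/-- Fenchel-Young inequality: `exp y - 1` is the convex conjugate of `klFun`. It follows from `x + 1
≤ exp x` at `x = y - log q`. -/
theorem mul_le_klFun_add_exp {q : ℝ} (hq : 0 ≤ q) (y : ℝ) :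
    q * y ≤ klFun q - 1 + Real.exp y := by
  rcases hq.eq_or_lt with rfl | hq
  · simp [klFun_zero, (Real.exp_pos y).le]
  · have h := Real.add_one_le_exp (y - Real.log q)
    rw [Real.exp_sub, Real.exp_log hq, le_div_iff₀ hq] at h
    rw [klFun_apply]
    nlinarith

/-- A probability measure at finite divergence from `P` integrates the positive part of a function
with a finite exponential moment under `P`. -/
theorem lintegral_ofReal_ne_top_of_klDiv_ne_top {P Q : Measure Ξ} [IsFiniteMeasure P]
    [IsFiniteMeasure Q] {g : Ξ → ℝ} (hg : Measurable g) {γ : ℝ} (hγ : 0 < γ)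
    (hexp : ∫⁻ ξ, ENNReal.ofReal (Real.exp (g ξ / γ)) ∂P ≠ ∞) (hkl : klDiv Q P ≠ ∞) :
    ∫⁻ ξ, ENNReal.ofReal (g ξ) ∂Q ≠ ∞ := by
  have hac := (klDiv_ne_top_iff.1 hkl).1
  rw [klDiv_eq_lintegral_klFun_of_ac hac] at hkl
  rw [← lintegral_rnDeriv_mul hac (by fun_prop)]
  have hlt : ENNReal.ofReal γ * (∫⁻ ξ, ENNReal.ofReal (klFun (Q.rnDeriv P ξ).toReal) ∂P +
      ∫⁻ ξ, ENNReal.ofReal (Real.exp (g ξ / γ)) ∂P) ≠ ∞ :=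
    ENNReal.mul_ne_top ENNReal.ofReal_ne_top (ENNReal.add_ne_top.2 ⟨hkl, hexp⟩)
  refine ne_top_of_le_ne_top hlt ?_
  rw [← lintegral_add_right _ (by fun_prop), ← lintegral_const_mul _ (by fun_prop)]
  refine lintegral_mono_ae ?_
  filter_upwards [Q.rnDeriv_ne_top P] with ξ hξ
  have hq : 0 ≤ (Q.rnDeriv P ξ).toReal := ENNReal.toReal_nonneg
  rcases le_total (g ξ) 0 with h0 | h0
  · simp [ENNReal.ofReal_of_nonpos h0]
  rw [← ENNReal.ofReal_toReal hξ, ENNReal.toReal_ofReal hq, ← ENNReal.ofReal_mul hq,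
    ← ENNReal.ofReal_add (klFun_nonneg hq) (Real.exp_pos _).le, ← ENNReal.ofReal_mul hγ.le]
  refine ENNReal.ofReal_le_ofReal ?_
  have h := mul_le_klFun_add_exp hq (g ξ / γ)
  calc (Q.rnDeriv P ξ).toReal * g ξ = γ * ((Q.rnDeriv P ξ).toReal * (g ξ / γ)) := by field_simp
    _ ≤ _ := by gcongr; linarith

theorem integrable_exp_of_lintegral_ne_top {P : Measure Ξ} {g : Ξ → ℝ} (hg : Measurable g)
    (h : ∫⁻ ξ, ENNReal.ofReal (Real.exp (g ξ)) ∂P ≠ ∞) :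
    Integrable (fun ξ => Real.exp (g ξ)) P := by
  refine ⟨by fun_prop, ?_⟩
  rw [hasFiniteIntegral_iff_ofReal (Filter.Eventually.of_forall fun ξ => (Real.exp_pos _).le)]
  exact h.lt_top

theorem log_lintegral_exp {P : Measure Ξ} [NeZero P] {g : Ξ → ℝ}
    (h : Integrable (fun ξ => Real.exp (g ξ)) P) :
    ENNReal.log (∫⁻ ξ, ENNReal.ofReal (Real.exp (g ξ)) ∂P) =
      ((Real.log (∫ ξ, Real.exp (g ξ) ∂P) : ℝ) : EReal) := by
  rw [← ofReal_integral_eq_lintegral_ofReal h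
    (Filter.Eventually.of_forall fun ξ => (Real.exp_pos _).le),
    ENNReal.log_ofReal_of_pos (integral_exp_pos h)]

/-- The Gibbs variational inequality. -/
theorem integral_le_klDiv_add_log_integral_exp {P Q : Measure Ξ} [IsProbabilityMeasure P]
    [IsProbabilityMeasure Q] {g : Ξ → ℝ} (hg : Integrable g Q)
    (hexp : Integrable (fun ξ => Real.exp (g ξ)) P) (hkl : klDiv Q P ≠ ∞) :
    ∫ ξ, g ξ ∂Q ≤ (klDiv Q P).toReal + Real.log (∫ ξ, Real.exp (g ξ) ∂P) := by
  obtain ⟨hac, hint⟩ := klDiv_ne_top_iff.1 hkl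
  have := isProbabilityMeasure_tilted hexp
  have h := integral_llr_tilted_right hac hg hexp hint
  have h0 := integral_llr_add_sub_measure_univ_nonneg
    (hac.trans (absolutelyContinuous_tilted hexp)) (integrable_llr_tilted_right hac hg hint hexp)
  rw [toReal_klDiv_of_measure_eq hac (by simp)]
  simp only [probReal_univ] at h0
  linarith

theorem extExpectation_le_essSup {P Q : Measure Ξ} [IsProbabilityMeasure P]
    [IsProbabilityMeasure Q] {g : Ξ → ℝ} (hg : Measurable g) (hac : Q ≪ P) :
    extExpectation Q g ≤ essSup (fun ξ => (g ξ : EReal)) P := by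
  have hle := ae_le_essSup (μ := P) (f := fun ξ => (g ξ : EReal))
  generalize essSup (fun ξ => (g ξ : EReal)) P = S at hle ⊢
  induction S with
  | top => exact le_top
  | bot =>
    obtain ⟨ξ, hξ⟩ := hle.exists
    simp at hξ
  | coe S =>
    have hle' : ∀ᵐ ξ ∂Q, g ξ ≤ S := by
      filter_upwards [hac.ae_le hle] with ξ hξ
      exact_mod_cast hξ
    refine extExpectation_le_of_integrable hg.aestronglyMeasurable ?_ fun hi => ?_
    · refine ne_top_of_le_ne_top (b := ∫⁻ _, ENNReal.ofReal S ∂Q) (by simp) ?_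
      exact lintegral_mono_ae (hle'.mono fun ξ hξ => ENNReal.ofReal_le_ofReal hξ)
    · have := integral_mono_ae hi (integrable_const S) hle'
      simp only [integral_const, probReal_univ, one_smul] at this
      exact_mod_cast this

/-- Weak duality: the Gibbs inequality for `g / γ`, multiplied by `γ`. At `γ = 0` only `Q ≪ P`
matters. -/
theorem extExpectation_le_scaledLogMGF {P Q : Measure Ξ} [IsProbabilityMeasure P]
    [IsProbabilityMeasure Q] {g : Ξ → ℝ} (hg : Measurable g) {r : ℝ} (hr : 0 ≤ r)
    (hkl : klDiv Q P ≤ ENNReal.ofReal r) (γ : ℝ≥0) :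
    extExpectation Q g ≤ (((γ : ℝ) * r : ℝ) : EReal) + scaledLogMGF P g γ := by
  have hkl' : klDiv Q P ≠ ∞ := ne_top_of_le_ne_top ENNReal.ofReal_ne_top hkl
  rcases eq_or_ne γ 0 with rfl | hγ
  · simpa [scaledLogMGF] using extExpectation_le_essSup hg (klDiv_ne_top_iff.1 hkl').1
  have hγ' : 0 < (γ : ℝ) := by positivity
  rw [scaledLogMGF, if_neg hγ]
  by_cases htop : ∫⁻ ξ, ENNReal.ofReal (Real.exp (g ξ / γ)) ∂P = ∞
  · rw [htop, ENNReal.log_top, EReal.coe_mul_top_of_pos hγ', EReal.coe_add_top]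
    exact le_top
  have hexp := integrable_exp_of_lintegral_ne_top (hg.div_const (γ : ℝ)) htop
  rw [log_lintegral_exp hexp, ← EReal.coe_mul, ← EReal.coe_add]
  refine extExpectation_le_of_integrable hg.aestronglyMeasurable
    (lintegral_ofReal_ne_top_of_klDiv_ne_top hg hγ' htop hkl') fun hi => ?_
  have h := integral_le_klDiv_add_log_integral_exp (hi.div_const (γ : ℝ)) hexp hkl'
  have hr' : (klDiv Q P).toReal ≤ r := ENNReal.toReal_le_of_le_ofReal hr hkl
  rw [integral_div, div_le_iff₀ hγ'] at h
  norm_cast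
  have := mul_le_mul_of_nonneg_left hr' hγ'.le
  nlinarith

end KLBall

/-! ### Densities of finite divergence and dual attainment -/

section Density

/-- The sublevel sets of `|g|` exhaust the space. -/
theorem iUnion_setOf_abs_le {Ξ : Type*} (g : Ξ → ℝ) : ⋃ m : ℕ, {ξ | |g ξ| ≤ m} = Set.univ := by
  ext ξ
  simpa using exists_nat_ge |g ξ|

theorem monotone_setOf_abs_le {Ξ : Type*} (g : Ξ → ℝ) : Monotone fun m : ℕ => {ξ | |g ξ| ≤ m} :=
  fun m _ h ξ (hξ : |g ξ| ≤ m) => hξ.trans (Nat.cast_le.2 h)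

variable {Ξ : Type*} [MeasurableSpace Ξ]

/-- `q` is a probability density with respect to `P` that has finite divergence from `P` and
integrates `g`. -/
structure IsKLDensity (P : Measure Ξ) (g q : Ξ → ℝ) : Prop where
  measurable : Measurable q
  nonneg : ∀ ξ, 0 ≤ q ξ
  integrable : Integrable q P
  integral_eq_one : ∫ ξ, q ξ ∂P = 1
  integrable_klFun : Integrable (fun ξ => klFun (q ξ)) P
  integrable_mul : Integrable (fun ξ => q ξ * g ξ) P

namespace IsKLDensity

variable {P : Measure Ξ} {g q : Ξ → ℝ}

theorem exists_probabilityMeasure [IsProbabilityMeasure P] (hq : IsKLDensity P g q) :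
    ∃ Q : ProbabilityMeasure Ξ,
      klDiv (Q : Measure Ξ) P = ENNReal.ofReal (∫ ξ, klFun (q ξ) ∂P) ∧
      extExpectation (Q : Measure Ξ) g = ((∫ ξ, q ξ * g ξ ∂P : ℝ) : EReal) := by
  have hm : Measurable fun ξ => ENNReal.ofReal (q ξ) := hq.measurable.ennreal_ofReal
  have hprob : IsProbabilityMeasure (P.withDensity fun ξ => ENNReal.ofReal (q ξ)) := by
    constructor
    rw [withDensity_apply _ MeasurableSet.univ, Measure.restrict_univ,
      ← ofReal_integral_eq_lintegral_ofReal hq.integrable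
        (Filter.Eventually.of_forall hq.nonneg), hq.integral_eq_one, ENNReal.ofReal_one]
  refine ⟨⟨_, hprob⟩, ?_, ?_⟩
  · change klDiv (P.withDensity fun ξ => ENNReal.ofReal (q ξ)) P = _
    rw [klDiv_eq_lintegral_klFun_of_ac (withDensity_absolutelyContinuous _ _),
      ofReal_integral_eq_lintegral_ofReal hq.integrable_klFun
        (Filter.Eventually.of_forall fun ξ => klFun_nonneg (hq.nonneg ξ))]
    refine lintegral_congr_ae ?_
    filter_upwards [Measure.rnDeriv_withDensity P hm] with ξ hξ
    rw [hξ, ENNReal.toReal_ofReal (hq.nonneg ξ)]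
  · change extExpectation (P.withDensity fun ξ => ENNReal.ofReal (q ξ)) g = _
    have hfin : ∀ᵐ ξ ∂P, ENNReal.ofReal (q ξ) < ∞ := by simp
    have hi : Integrable g (P.withDensity fun ξ => ENNReal.ofReal (q ξ)) := by
      rw [integrable_withDensity_iff_integrable_smul' hm hfin]
      refine hq.integrable_mul.congr (Filter.Eventually.of_forall fun ξ => ?_)
      simp [ENNReal.toReal_ofReal (hq.nonneg ξ)]
    rw [extExpectation_of_integrable hi, integral_withDensity_eq_integral_toReal_smul hm hfin]
    congr 1
    refine integral_congr_ae (Filter.Eventually.of_forall fun ξ => ?_)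
    simp [ENNReal.toReal_ofReal (hq.nonneg ξ)]

theorem convexCombo {q' : Ξ → ℝ} (hq : IsKLDensity P g q) (hq' : IsKLDensity P g q') {a b : ℝ}
    (ha : 0 ≤ a) (hb : 0 ≤ b) (hab : a + b = 1) :
    IsKLDensity P g (fun ξ => a * q ξ + b * q' ξ) ∧
    ∫ ξ, klFun (a * q ξ + b * q' ξ) ∂P ≤
      a * ∫ ξ, klFun (q ξ) ∂P + b * ∫ ξ, klFun (q' ξ) ∂P ∧
    ∫ ξ, (a * q ξ + b * q' ξ) * g ξ ∂P = a * ∫ ξ, q ξ * g ξ ∂P + b * ∫ ξ, q' ξ * g ξ ∂P := by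
  have hnn : ∀ ξ, 0 ≤ a * q ξ + b * q' ξ := fun ξ =>
    add_nonneg (mul_nonneg ha (hq.nonneg ξ)) (mul_nonneg hb (hq'.nonneg ξ))
  have hle : ∀ ξ, klFun (a * q ξ + b * q' ξ) ≤ a * klFun (q ξ) + b * klFun (q' ξ) := fun ξ =>
    convexOn_klFun.2 (hq.nonneg ξ) (hq'.nonneg ξ) ha hb hab
  have hm : Measurable fun ξ => a * q ξ + b * q' ξ :=
    (hq.measurable.const_mul a).add (hq'.measurable.const_mul b)
  have hi := (hq.integrable_klFun.const_mul a).add (hq'.integrable_klFun.const_mul b)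
  have hik : Integrable (fun ξ => klFun (a * q ξ + b * q' ξ)) P := by
    refine hi.mono' (measurable_klFun.comp hm).aestronglyMeasurable
      (Filter.Eventually.of_forall fun ξ => ?_)
    rw [Real.norm_of_nonneg (klFun_nonneg (hnn ξ))]
    exact hle ξ
  have hmul : (fun ξ => (a * q ξ + b * q' ξ) * g ξ) =
      fun ξ => a * (q ξ * g ξ) + b * (q' ξ * g ξ) := by
    ext ξ; ring
  refine ⟨⟨hm, hnn, (hq.integrable.const_mul a).add (hq'.integrable.const_mul b), ?_, hik, ?_⟩,
    ?_, ?_⟩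
  · rw [integral_add (hq.integrable.const_mul a) (hq'.integrable.const_mul b),
      integral_const_mul, integral_const_mul, hq.integral_eq_one, hq'.integral_eq_one]
    linarith
  · rw [hmul]
    exact (hq.integrable_mul.const_mul a).add (hq'.integrable_mul.const_mul b)
  · rw [← integral_const_mul, ← integral_const_mul,
      ← integral_add (hq.integrable_klFun.const_mul a) (hq'.integrable_klFun.const_mul b)]
    exact integral_mono hik hi hle
  · rw [hmul, integral_add (hq.integrable_mul.const_mul a) (hq'.integrable_mul.const_mul b),
      integral_const_mul, integral_const_mul]

/-- The slack in the first coordinate is essential: `klFun` is convex, so mixing densities only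
bounds the divergence from above. -/
theorem convex_setOf : Convex ℝ {p : ℝ × ℝ | ∃ q, IsKLDensity P g q ∧
    ∫ ξ, klFun (q ξ) ∂P ≤ p.1 ∧ p.2 ≤ ∫ ξ, q ξ * g ξ ∂P} := by
  rintro ⟨k, e⟩ ⟨q, hq, hk, he⟩ ⟨k', e'⟩ ⟨q', hq', hk', he'⟩ a b ha hb hab
  obtain ⟨h, h1, h2⟩ := hq.convexCombo hq' ha hb hab
  refine ⟨_, h, h1.trans ?_, ?_⟩
  · exact add_le_add (mul_le_mul_of_nonneg_left hk ha) (mul_le_mul_of_nonneg_left hk' hb)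
  · rw [h2]
    exact add_le_add (mul_le_mul_of_nonneg_left he ha) (mul_le_mul_of_nonneg_left he' hb)

/-- The Gibbs density of `u * g` on a set where `g` is bounded. -/
theorem exists_gibbs [IsProbabilityMeasure P] (hg : Measurable g) {B : Set Ξ}
    (hB : MeasurableSet B) {m : ℝ} (hm : ∀ ξ ∈ B, |g ξ| ≤ m) (hPB : P B ≠ 0) (u : ℝ) :
    ∃ q, IsKLDensity P g q ∧ (∀ ξ ∉ B, q ξ = 0) ∧ ∫ ξ, klFun (q ξ) ∂P =
      u * ∫ ξ, q ξ * g ξ ∂P - Real.log (∫ ξ in B, Real.exp (u * g ξ) ∂P) := by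
  have hug : ∀ ξ ∈ B, |u * g ξ| ≤ |u| * m := fun ξ hξ => by
    rw [abs_mul]; exact mul_le_mul_of_nonneg_left (hm ξ hξ) (abs_nonneg u)
  have hexpB : IntegrableOn (fun ξ => Real.exp (u * g ξ)) B P := by
    refine Measure.integrableOn_of_bounded (measure_ne_top P B) (by fun_prop)
      (M := Real.exp (|u| * m)) ?_
    refine (ae_restrict_mem hB).mono fun ξ hξ => ?_
    rw [Real.norm_of_nonneg (Real.exp_pos _).le, Real.exp_le_exp]
    exact (le_abs_self _).trans (hug ξ hξ)
  set Z := ∫ ξ in B, Real.exp (u * g ξ) ∂P with hZ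
  have hZpos : 0 < Z := by
    have : NeZero (P.restrict B) := ⟨by simpa [Measure.restrict_eq_zero] using hPB⟩
    exact integral_exp_pos hexpB
  set q : Ξ → ℝ := B.indicator fun ξ => Real.exp (u * g ξ) / Z with hqdef
  have hqB : ∀ ξ ∈ B, q ξ = Real.exp (u * g ξ) / Z := fun ξ hξ => Set.indicator_of_mem hξ _
  have hqB' : ∀ ξ ∉ B, q ξ = 0 := fun ξ hξ => Set.indicator_of_notMem hξ _
  have hqm : Measurable q := Measurable.indicator (by fun_prop) hB
  have hq0 : ∀ ξ, 0 ≤ q ξ := fun ξ => Set.indicator_nonneg (fun ξ _ => by positivity) ξ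
  have hqi : Integrable q P := (integrable_indicator_iff hB).2 (hexpB.div_const Z)
  have hq1 : ∫ ξ, q ξ ∂P = 1 := by
    rw [hqdef, integral_indicator hB, integral_div, ← hZ, div_self hZpos.ne']
  have hqg : Integrable (fun ξ => q ξ * g ξ) P := by
    refine (hqi.mul_const m).mono' (hqm.mul hg).aestronglyMeasurable
      (Filter.Eventually.of_forall fun ξ => ?_)
    by_cases hξ : ξ ∈ B
    · rw [norm_mul, Real.norm_of_nonneg (hq0 ξ)]
      exact mul_le_mul_of_nonneg_left (hm ξ hξ) (hq0 ξ)
    · simp [hqB' ξ hξ]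
  -- On `B`, `log q = u g - log Z`. Off `B`, `q = 0` and `klFun 0 = 1`, which the term `1 - q`
  -- accounts for; that term integrates to zero.
  have hkl : (fun ξ => klFun (q ξ)) =
      fun ξ => u * (q ξ * g ξ) - Real.log Z * q ξ + (1 - q ξ) := by
    ext ξ
    rw [klFun_apply]
    by_cases hξ : ξ ∈ B
    · have : Real.log (q ξ) = u * g ξ - Real.log Z := by
        rw [hqB ξ hξ, Real.log_div (Real.exp_pos _).ne' hZpos.ne', Real.log_exp]
      rw [this]; ring
    · simp [hqB' ξ hξ]
  have hi1 := (hqg.const_mul u).sub (hqi.const_mul (Real.log Z))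
  have hi2 := (integrable_const (1 : ℝ)).sub hqi
  refine ⟨q, ⟨hqm, hq0, hqi, hq1, ?_, hqg⟩, hqB', ?_⟩
  · rw [hkl]; exact hi1.add hi2
  · rw [hkl, integral_add (f := fun ξ => u * (q ξ * g ξ) - Real.log Z * q ξ)
      (g := fun ξ => 1 - q ξ) hi1 hi2,
      integral_sub (hqg.const_mul u) (hqi.const_mul _), integral_sub (integrable_const _) hqi,
      integral_const_mul, integral_const_mul, hq1]
    simp

end IsKLDensity

theorem measurableSet_setOf_abs_le {g : Ξ → ℝ} (hg : Measurable g) (m : ℕ) :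
    MeasurableSet {ξ | |g ξ| ≤ m} := measurableSet_le hg.abs measurable_const

/-- A Slater point. The density `1` itself may fail to integrate `g`, so `P` is conditioned on `{|g|
≤ m}` (Gibbs density with `u = 0`); the divergence `-log P {|g| ≤ m}` tends to `0`. -/
theorem exists_isKLDensity_integral_klFun_lt {P : Measure Ξ} [IsProbabilityMeasure P] {g : Ξ → ℝ}
    (hg : Measurable g) {r : ℝ} (hr : 0 < r) :
    ∃ q, IsKLDensity P g q ∧ ∫ ξ, klFun (q ξ) ∂P < r := by
  have ht := tendsto_measure_iUnion_atTop (μ := P) (monotone_setOf_abs_le g)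
  rw [iUnion_setOf_abs_le, measure_univ] at ht
  have hlt : ENNReal.ofReal (Real.exp (-r)) < 1 := by
    rw [ENNReal.ofReal_lt_one, ← Real.exp_zero, Real.exp_lt_exp]; linarith
  obtain ⟨m, hm⟩ := (ht.eventually (lt_mem_nhds hlt)).exists
  simp only [Function.comp] at hm
  obtain ⟨q, hq, -, hkl⟩ := IsKLDensity.exists_gibbs hg (measurableSet_setOf_abs_le hg m)
    (fun ξ hξ => hξ) (ne_bot_of_gt hm) 0
  refine ⟨q, hq, ?_⟩
  simp only [zero_mul, Real.exp_zero, integral_const, zero_sub] at hkl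
  rw [hkl, neg_lt]
  rw [ENNReal.ofReal_lt_iff_lt_toReal (Real.exp_pos _).le (measure_ne_top _ _)] at hm
  rw [Real.lt_log_iff_exp_lt (by simpa [Measure.real] using (Real.exp_pos _).trans hm)]
  simpa [Measure.real] using hm

/-- If `{V < g, |g| ≤ m}` had positive mass, `P` conditioned on it would give `g` a mean above `V`.
-/
theorem essSup_le_of_isKLDensity {P : Measure Ξ} [IsProbabilityMeasure P] {g : Ξ → ℝ}
    (hg : Measurable g) {V : ℝ} (hV : ∀ q, IsKLDensity P g q → ∫ ξ, q ξ * g ξ ∂P ≤ V) :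
    essSup (fun ξ => (g ξ : EReal)) P ≤ V := by
  refine essSup_le_of_ae_le _ ?_
  have hall : ∀ m : ℕ, P ({ξ | V < g ξ} ∩ {ξ | |g ξ| ≤ m}) = 0 := by
    intro m
    by_contra hne
    have hB : MeasurableSet ({ξ | V < g ξ} ∩ {ξ | |g ξ| ≤ m}) :=
      (measurableSet_lt measurable_const hg).inter (measurableSet_setOf_abs_le hg m)
    obtain ⟨q, hq, hq0, -⟩ := IsKLDensity.exists_gibbs hg hB (fun ξ hξ => hξ.2) hne 0
    have hnn : ∀ ξ, 0 ≤ q ξ * g ξ - q ξ * V := fun ξ => by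
      by_cases hξ : ξ ∈ {ξ | V < g ξ} ∩ {ξ | |g ξ| ≤ m}
      · rw [← mul_sub]
        exact mul_nonneg (hq.nonneg ξ) (sub_nonneg.2 (le_of_lt hξ.1))
      · simp [hq0 ξ hξ]
    have hint : ∫ ξ, (q ξ * g ξ - q ξ * V) ∂P ≤ 0 := by
      rw [integral_sub hq.integrable_mul (hq.integrable.mul_const V), integral_mul_const,
        hq.integral_eq_one]
      linarith [hV q hq]
    have hz := (integral_eq_zero_iff_of_nonneg hnn
      (hq.integrable_mul.sub (hq.integrable.mul_const V))).1
      (le_antisymm hint (integral_nonneg hnn))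
    have hq0' : q =ᵐ[P] 0 := by
      filter_upwards [hz] with ξ hξ
      by_cases hmem : ξ ∈ {ξ | V < g ξ} ∩ {ξ | |g ξ| ≤ m}
      · simp only [Pi.zero_apply, ← mul_sub, mul_eq_zero] at hξ
        exact hξ.resolve_right (sub_pos.2 hmem.1).ne'
      · exact hq0 ξ hmem
    have := hq.integral_eq_one
    rw [integral_congr_ae hq0'] at this
    simp at this
  have hunion : P {ξ | V < g ξ} = 0 := by
    rw [← Set.inter_univ {ξ | V < g ξ}, ← iUnion_setOf_abs_le g, Set.inter_iUnion]
    exact measure_iUnion_null hall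
  filter_upwards [measure_eq_zero_iff_ae_notMem.1 hunion] with ξ hξ
  exact_mod_cast not_lt.1 hξ

/-- For the Gibbs density of `g / γ` on `{|g| ≤ m}`, the Gibbs inequality is an equality, so `hc`
bounds the truncated exponential moment by `exp (c / γ)`. Monotone convergence in `m` removes the
truncation. -/
theorem scaledLogMGF_le_of_isKLDensity {P : Measure Ξ} [IsProbabilityMeasure P] {g : Ξ → ℝ}
    (hg : Measurable g) {γ : ℝ≥0} (hγ : γ ≠ 0) {c : ℝ}
    (hc : ∀ q, IsKLDensity P g q → ∫ ξ, q ξ * g ξ ∂P ≤ c + γ * ∫ ξ, klFun (q ξ) ∂P) :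
    scaledLogMGF P g γ ≤ c := by
  have hγ' : 0 < (γ : ℝ) := by positivity
  have hle : ∫⁻ ξ, ENNReal.ofReal (Real.exp (g ξ / γ)) ∂P ≤ ENNReal.ofReal (Real.exp (c / γ)) := by
    have hmono := setLIntegral_iUnion_of_directed (μ := P)
      (fun ξ => ENNReal.ofReal (Real.exp (g ξ / γ)))
      (monotone_setOf_abs_le g).directed_le
    rw [iUnion_setOf_abs_le, setLIntegral_univ] at hmono
    rw [hmono]
    refine iSup_le fun m => ?_
    by_cases hPB : P {ξ | |g ξ| ≤ m} = 0
    · rw [Measure.restrict_eq_zero.2 hPB]; simp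
    obtain ⟨q, hq, -, hkl⟩ := IsKLDensity.exists_gibbs hg (measurableSet_setOf_abs_le hg m)
      (fun ξ hξ => hξ) hPB (γ : ℝ)⁻¹
    have hb := hc q hq
    have hi : IntegrableOn (fun ξ => Real.exp (g ξ / γ)) {ξ | |g ξ| ≤ m} P := by
      refine Measure.integrableOn_of_bounded (measure_ne_top P _) (by fun_prop)
        (M := Real.exp (m / γ)) ?_
      refine (ae_restrict_mem (measurableSet_setOf_abs_le hg m)).mono fun ξ hξ => ?_
      rw [Real.norm_of_nonneg (Real.exp_pos _).le, Real.exp_le_exp]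
      gcongr
      exact (le_abs_self _).trans hξ
    have : NeZero (P.restrict {ξ | |g ξ| ≤ m}) :=
      ⟨by simpa [Measure.restrict_eq_zero] using hPB⟩
    rw [← ofReal_integral_eq_lintegral_ofReal hi
      (Filter.Eventually.of_forall fun ξ => (Real.exp_pos _).le)]
    refine ENNReal.ofReal_le_ofReal ?_
    rw [← Real.log_le_iff_le_exp (integral_exp_pos hi), le_div_iff₀ hγ']
    simp only [div_eq_inv_mul]
    rw [hkl, mul_sub, mul_inv_cancel_left₀ hγ'.ne'] at hb
    linarith
  rw [scaledLogMGF, if_neg hγ]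
  calc ((γ : ℝ) : EReal) * ENNReal.log (∫⁻ ξ, ENNReal.ofReal (Real.exp (g ξ / γ)) ∂P)
      ≤ ((γ : ℝ) : EReal) * ENNReal.log (ENNReal.ofReal (Real.exp (c / γ))) := by
        refine mul_le_mul_of_nonneg_left (ENNReal.log_le_log hle) ?_
        exact_mod_cast hγ'.le
    _ = c := by
        rw [ENNReal.log_ofReal_of_pos (Real.exp_pos _), Real.log_exp, ← EReal.coe_mul,
          mul_div_cancel₀ _ hγ'.ne']

/-- Attainment in the dual at a positive radius. -/
theorem exists_dual_le_of_isKLDensity {P : Measure Ξ} [IsProbabilityMeasure P] {g : Ξ → ℝ}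
    (hg : Measurable g) {r : ℝ} (hr : 0 < r) {V : ℝ}
    (hV : ∀ q, IsKLDensity P g q → ∫ ξ, klFun (q ξ) ∂P ≤ r → ∫ ξ, q ξ * g ξ ∂P ≤ V) :
    ∃ γ : ℝ≥0, (((γ : ℝ) * r : ℝ) : EReal) + scaledLogMGF P g γ ≤ V := by
  obtain ⟨q₀, hq₀, hlt⟩ := exists_isKLDensity_integral_klFun_lt (P := P) hg hr
  obtain ⟨γ, hγ, hline⟩ := exists_nonneg_slope_of_convex
    (IsKLDensity.convex_setOf (P := P) (g := g)) (r := r) (V := V)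
    (by rintro p ⟨q, hq, hk, he⟩ hp
        exact he.trans (hV q hq (hk.trans hp)))
    ⟨(_, _), ⟨q₀, hq₀, le_rfl, le_rfl⟩, hlt⟩
  have hline' : ∀ q, IsKLDensity P g q →
      ∫ ξ, q ξ * g ξ ∂P ≤ V - γ * r + γ * ∫ ξ, klFun (q ξ) ∂P := fun q hq => by
    have := hline (_, _) ⟨q, hq, le_rfl, le_rfl⟩
    simp only at this
    linarith
  lift γ to ℝ≥0 using hγ
  have hs : scaledLogMGF P g γ ≤ ((V - γ * r : ℝ) : EReal) := by
    rcases eq_or_ne γ 0 with rfl | hne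
    · simp only [scaledLogMGF, if_true]
      refine essSup_le_of_isKLDensity hg fun q hq => ?_
      simpa using hline' q hq
    · exact scaledLogMGF_le_of_isKLDensity hg hne hline'
  refine ⟨γ, (add_le_add_right hs _).trans ?_⟩
  rw [← EReal.coe_add]
  exact_mod_cast (by linarith : (γ : ℝ) * r + (V - γ * r) ≤ V)

end Density

/-! ### The zero radius and strong duality -/

section Duality

open Filter Topology

variable {Ξ : Type*} [MeasurableSpace Ξ]

theorem le_mul_exp_div_sub_one {γ : ℝ} (hγ : 0 < γ) (y : ℝ) : y ≤ γ * (Real.exp (y / γ) - 1) := by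
  have h := Real.add_one_le_exp (y / γ)
  calc y = γ * (y / γ) := by field_simp
    _ ≤ _ := mul_le_mul_of_nonneg_left (by linarith) hγ.le

theorem mul_exp_div_sub_one_le {γ : ℝ} (hγ : 0 < γ) (y : ℝ) :
    γ * (Real.exp (y / γ) - 1) ≤ y * Real.exp (y / γ) := by
  have h := Real.add_one_le_exp (-(y / γ))
  have h' := mul_le_mul_of_nonneg_right h (Real.exp_pos (y / γ)).le
  rw [← Real.exp_add, neg_add_cancel, Real.exp_zero] at h'
  calc γ * (Real.exp (y / γ) - 1) ≤ γ * (y / γ * Real.exp (y / γ)) :=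
        mul_le_mul_of_nonneg_left (by linarith) hγ.le
    _ = _ := by field_simp

/-- Convexity of `exp`, since `y / γ` lies between `0` and `y / γ₀`. This monotonicity supplies both
the dominating function and the monotone convergence used for `γ → ∞`. -/
theorem mul_exp_div_sub_one_anti {γ₀ γ : ℝ} (hγ₀ : 0 < γ₀) (h : γ₀ ≤ γ) (y : ℝ) :
    γ * (Real.exp (y / γ) - 1) ≤ γ₀ * (Real.exp (y / γ₀) - 1) := by
  have hγ := hγ₀.trans_le h
  have h0 : 0 ≤ γ₀ / γ := by positivity
  have h1 : 0 ≤ 1 - γ₀ / γ := by rw [sub_nonneg, div_le_one hγ]; exact h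
  have hc := convexOn_exp.2 (Set.mem_univ (y / γ₀)) (Set.mem_univ 0) h0 h1 (by ring)
  have he : (γ₀ / γ) • (y / γ₀) + (1 - γ₀ / γ) • (0 : ℝ) = y / γ := by
    simp only [smul_eq_mul]; field_simp; ring
  rw [he, Real.exp_zero] at hc
  simp only [smul_eq_mul] at hc
  calc γ * (Real.exp (y / γ) - 1)
      ≤ γ * (γ₀ / γ * Real.exp (y / γ₀) + (1 - γ₀ / γ) * 1 - 1) :=
        mul_le_mul_of_nonneg_left (by linarith) hγ.le
    _ = _ := by field_simp; ring

theorem tendsto_mul_exp_div_sub_one (y : ℝ) :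
    Tendsto (fun γ : ℝ => γ * (Real.exp (y / γ) - 1)) atTop (𝓝 y) := by
  have h : Tendsto (fun γ : ℝ => y * Real.exp (y / γ)) atTop (𝓝 (y * Real.exp 0)) :=
    ((Real.continuous_exp.tendsto 0).comp (tendsto_const_nhds.div_atTop tendsto_id)).const_mul y
  rw [Real.exp_zero, mul_one] at h
  refine tendsto_of_tendsto_of_tendsto_of_le_of_le' tendsto_const_nhds h ?_ ?_
  · filter_upwards [eventually_gt_atTop 0] with γ hγ using le_mul_exp_div_sub_one hγ y
  · filter_upwards [eventually_gt_atTop 0] with γ hγ using mul_exp_div_sub_one_le hγ y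

/-- The bound `log x ≤ x - 1` trades the logarithm of an expectation for an expectation, to which
limit theorems apply. -/
theorem scaledLogMGF_le_extExpectation {P : Measure Ξ} [IsProbabilityMeasure P] {g : Ξ → ℝ}
    {γ : ℝ≥0} (hγ : γ ≠ 0) (hexp : Integrable (fun ξ => Real.exp (g ξ / γ)) P) :
    scaledLogMGF P g γ ≤ extExpectation P fun ξ => γ * (Real.exp (g ξ / γ) - 1) := by
  have hi : Integrable (fun ξ => (γ : ℝ) * (Real.exp (g ξ / γ) - 1)) P :=
    (hexp.sub (integrable_const 1)).const_mul (γ : ℝ)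
  rw [scaledLogMGF, if_neg hγ, extExpectation_of_integrable hi, log_lintegral_exp hexp, ← EReal.coe_mul,
    EReal.coe_le_coe_iff, integral_const_mul, integral_sub hexp (integrable_const 1)]
  refine mul_le_mul_of_nonneg_left ?_ γ.2
  simpa using Real.log_le_sub_one_of_pos (integral_exp_pos hexp)

theorem iInf_scaledLogMGF_le_extExpectation {P : Measure Ξ} [IsProbabilityMeasure P] {g : Ξ → ℝ}
    (hg : Measurable g)
    (hmgf : ∃ t : ℝ, 0 < t ∧ ∫⁻ ξ, ENNReal.ofReal (Real.exp (t * g ξ)) ∂P < ∞) :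
    ⨅ γ : ℝ≥0, scaledLogMGF P g γ ≤ extExpectation P g := by
  obtain ⟨t, ht, hfin⟩ := hmgf
  -- Starting at `t⁻¹` lets the assumed moment dominate every `F n` from above.
  set c : ℕ → ℝ := fun n => t⁻¹ + n with hc
  have hc0 : ∀ n, t⁻¹ ≤ c n := fun n => by simp [hc]
  have ht' : 0 < t⁻¹ := by positivity
  have hcpos : ∀ n, 0 < c n := fun n => ht'.trans_le (hc0 n)
  have hctop : Tendsto c atTop atTop :=
    tendsto_atTop_add_const_left _ _ tendsto_natCast_atTop_atTop
  set F : ℕ → Ξ → ℝ := fun n ξ => c n * (Real.exp (g ξ / c n) - 1) with hF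
  have hFm : ∀ n, Measurable (F n) := fun n => by fun_prop
  have hlim : ∀ ξ, Tendsto (fun n => F n ξ) atTop (𝓝 (g ξ)) := fun ξ =>
    (tendsto_mul_exp_div_sub_one (g ξ)).comp hctop
  have hexp0 : Integrable (fun ξ => Real.exp (t * g ξ)) P :=
    integrable_exp_of_lintegral_ne_top (hg.const_mul t) hfin.ne
  have hF0 : ∀ n ξ, F n ξ ≤ t⁻¹ * Real.exp (t * g ξ) := fun n ξ => by
    refine (mul_exp_div_sub_one_anti ht' (hc0 n) (g ξ)).trans ?_
    rw [div_inv_eq_mul, mul_comm (g ξ)]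
    exact mul_le_mul_of_nonneg_left (by linarith) ht'.le
  have hexp : ∀ n, Integrable (fun ξ => Real.exp (g ξ / c n)) P := fun n => by
    refine ((hexp0.const_mul t⁻¹).const_mul (c n)⁻¹ |>.add (integrable_const 1)).mono'
      (by fun_prop) (Eventually.of_forall fun ξ => ?_)
    rw [Real.norm_of_nonneg (Real.exp_pos _).le]
    have h1 : Real.exp (g ξ / c n) = (c n)⁻¹ * F n ξ + 1 := by
      simp only [hF]; rw [inv_mul_cancel_left₀ (hcpos n).ne']; ring
    have h2 := mul_le_mul_of_nonneg_left (hF0 n ξ) (inv_nonneg.2 (hcpos n).le)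
    rw [h1]
    exact add_le_add_left h2 1
  have hle : ∀ n, ⨅ γ : ℝ≥0, scaledLogMGF P g γ ≤ extExpectation P (F n) := fun n => by
    have hne : (⟨c n, (hcpos n).le⟩ : ℝ≥0) ≠ 0 := fun h => (hcpos n).ne' (congrArg NNReal.toReal h)
    exact (iInf_le _ _).trans (scaledLogMGF_le_extExpectation hne (hexp n))
  have hfinP : ∫⁻ ξ, ENNReal.ofReal (t⁻¹ * Real.exp (t * g ξ)) ∂P ≠ ∞ :=
    (hexp0.const_mul t⁻¹).lintegral_lt_top.ne
  have hpos : Tendsto (fun n => ∫⁻ ξ, ENNReal.ofReal (F n ξ) ∂P) atTop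
      (𝓝 (∫⁻ ξ, ENNReal.ofReal (g ξ) ∂P)) :=
    tendsto_lintegral_of_dominated_convergence _ (fun n => (hFm n).ennreal_ofReal)
      (fun n => Eventually.of_forall fun ξ => ENNReal.ofReal_le_ofReal (hF0 n ξ)) hfinP
      (Eventually.of_forall fun ξ => ENNReal.tendsto_ofReal (hlim ξ))
  -- The negative parts increase to that of `g`, whose integral may be infinite; hence monotone
  -- rather than dominated convergence.
  have hneg : Tendsto (fun n => ∫⁻ ξ, ENNReal.ofReal (-F n ξ) ∂P) atTop
      (𝓝 (∫⁻ ξ, ENNReal.ofReal (-g ξ) ∂P)) := by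
    refine lintegral_tendsto_of_tendsto_of_monotone
      (fun n => (hFm n).neg.ennreal_ofReal.aemeasurable)
      (Eventually.of_forall fun ξ n m hnm => ENNReal.ofReal_le_ofReal (neg_le_neg ?_))
      (Eventually.of_forall fun ξ => ENNReal.tendsto_ofReal (hlim ξ).neg)
    refine mul_exp_div_sub_one_anti (hcpos n) ?_ (g ξ)
    simpa [hc] using hnm
  have hgfin : ∫⁻ ξ, ENNReal.ofReal (g ξ) ∂P ≠ ∞ := by
    refine ne_top_of_le_ne_top hfinP (lintegral_mono fun ξ => ENNReal.ofReal_le_ofReal ?_)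
    exact (le_mul_exp_div_sub_one (hcpos 0) (g ξ)).trans (hF0 0 ξ)
  refine ge_of_tendsto' (x := atTop) ?_ hle
  have h1 := (continuous_coe_ennreal_ereal.tendsto _).comp hpos
  have h2 := (continuous_neg.tendsto _).comp ((continuous_coe_ennreal_ereal.tendsto _).comp hneg)
  -- Finiteness of the positive part excludes `⊤ - ⊤`.
  have hadd : ContinuousAt (fun p : EReal × EReal => p.1 + p.2)
      (((∫⁻ ξ, ENNReal.ofReal (g ξ) ∂P : ℝ≥0∞) : EReal),
        -((∫⁻ ξ, ENNReal.ofReal (-g ξ) ∂P : ℝ≥0∞) : EReal)) :=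
    EReal.continuousAt_add (Or.inl (by simpa using hgfin)) (Or.inl (by simp))
  exact (hadd.tendsto.comp (h1.prodMk_nhds h2) :)

/-- Strong duality for the worst-case risk over a Kullback-Leibler ball. -/
theorem worstCaseRisk_klBall {P : Measure Ξ} [IsProbabilityMeasure P] {g : Ξ → ℝ}
    (hg : Measurable g)
    (hmgf : ∃ t : ℝ, 0 < t ∧ ∫⁻ ξ, ENNReal.ofReal (Real.exp (t * g ξ)) ∂P < ∞)
    {r : ℝ} (hr : 0 ≤ r) :
    worstCaseRisk {Q | klDiv (Q : Measure Ξ) P ≤ ENNReal.ofReal r} g =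
      ⨅ γ : ℝ≥0, (((γ : ℝ) * r : ℝ) : EReal) + scaledLogMGF P g γ := by
  refine le_antisymm ?_ ?_
  · exact iSup₂_le fun Q hQ => le_iInf fun γ => extExpectation_le_scaledLogMGF hg hr hQ γ
  rcases hr.eq_or_lt with rfl | hr
  -- At radius `0` the centre `P` is the competitor.
  · simp only [mul_zero, EReal.coe_zero, zero_add]
    refine (iInf_scaledLogMGF_le_extExpectation hg hmgf).trans ?_
    refine le_iSup₂_of_le (⟨P, inferInstance⟩ : ProbabilityMeasure Ξ) ?_ le_rfl
    change klDiv P P ≤ _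
    simp
  · have hle : ∀ q, IsKLDensity P g q → ∫ ξ, klFun (q ξ) ∂P ≤ r →
        ((∫ ξ, q ξ * g ξ ∂P : ℝ) : EReal) ≤
          worstCaseRisk {Q | klDiv (Q : Measure Ξ) P ≤ ENNReal.ofReal r} g := fun q hq hk => by
      obtain ⟨Q, hQ, hE⟩ := hq.exists_probabilityMeasure
      rw [← hE]
      exact le_iSup₂_of_le Q (hQ.le.trans (ENNReal.ofReal_le_ofReal hk)) le_rfl
    generalize worstCaseRisk {Q | klDiv (Q : Measure Ξ) P ≤ ENNReal.ofReal r} g = W at hle ⊢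
    induction W with
    | top => exact le_top
    | bot =>
      obtain ⟨q, hq, hk⟩ := exists_isKLDensity_integral_klFun_lt (P := P) hg hr
      exact absurd (le_bot_iff.1 (hle q hq hk.le)) (EReal.coe_ne_bot _)
    | coe V =>
      obtain ⟨γ, hγ⟩ := exists_dual_le_of_isKLDensity hg hr
        fun q hq hk => EReal.coe_le_coe_iff.1 (hle q hq hk)
      exact (iInf_le _ γ).trans hγ

end Duality

/-! ### Averaging the divergence over a family of tilts -/

section AverageKL

variable {Ξ : Type*} [MeasurableSpace Ξ]

/-- With `q = dQ/dP`, the density of `Q` with respect to the tilt is `q exp(-L)`, and `exp(L) klFun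
(q exp(-L))` is the integrand shown. Keeping `exp L - 1` inside makes it pointwise nonnegative, so
`L` need not be `Q`-integrable. -/
theorem klDiv_withDensity_exp {P Q : Measure Ξ} [IsFiniteMeasure P] [IsFiniteMeasure Q]
    (hac : Q ≪ P) {L : Ξ → ℝ} (hL : Measurable L)
    [IsFiniteMeasure (P.withDensity fun ξ => ENNReal.ofReal (Real.exp (L ξ)))] :
    klDiv Q (P.withDensity fun ξ => ENNReal.ofReal (Real.exp (L ξ))) =
      ∫⁻ ξ, ENNReal.ofReal (klFun (Q.rnDeriv P ξ).toReal - (Q.rnDeriv P ξ).toReal * L ξ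
        + Real.exp (L ξ) - 1) ∂P := by
  have hm : Measurable fun ξ => ENNReal.ofReal (Real.exp (L ξ)) := by fun_prop
  have hne : ∀ ξ, ENNReal.ofReal (Real.exp (L ξ)) ≠ 0 := fun ξ => by
    simpa using Real.exp_pos (L ξ)
  have hac' : P ≪ P.withDensity fun ξ => ENNReal.ofReal (Real.exp (L ξ)) :=
    withDensity_absolutelyContinuous' hm.aemeasurable (Filter.Eventually.of_forall hne)
  rw [klDiv_eq_lintegral_klFun_of_ac (hac.trans hac'),
    lintegral_withDensity_eq_lintegral_mul P hm (by fun_prop)]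
  refine lintegral_congr_ae ?_
  filter_upwards [Measure.rnDeriv_withDensity_right Q P hm.aemeasurable
    (Filter.Eventually.of_forall hne) (Filter.Eventually.of_forall fun ξ => ENNReal.ofReal_ne_top)]
    with ξ hξ
  have he := Real.exp_pos (L ξ)
  simp only [Pi.mul_apply]
  rw [hξ, ← ENNReal.ofReal_mul he.le, ENNReal.toReal_mul, ENNReal.toReal_inv,
    ENNReal.toReal_ofReal he.le]
  congr 1
  have hq : 0 ≤ (Q.rnDeriv P ξ).toReal := ENNReal.toReal_nonneg
  generalize (Q.rnDeriv P ξ).toReal = q at hq ⊢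
  rw [klFun_apply, klFun_apply]
  rcases hq.eq_or_lt with rfl | hq
  · simp
  · rw [Real.log_mul (inv_ne_zero he.ne') hq.ne', Real.log_inv, Real.log_exp]
    field_simp
    ring

/-- Averaging the divergence from exponentially tilted measures, whose log-densities average to a
constant, shifts the divergence by that constant. -/
theorem lintegral_klDiv_withDensity_exp {E : Type*} [MeasurableSpace E] {Post : Measure E}
    [IsProbabilityMeasure Post] {P Q : Measure Ξ} [IsProbabilityMeasure P]
    [IsProbabilityMeasure Q] (hac : Q ≪ P) {L : E → Ξ → ℝ}
    (hL : Measurable (Function.uncurry L)) {G : ℝ} (hG : 0 ≤ G)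
    (hLint : ∀ ξ, Integrable (fun η => L η ξ) Post) (hLG : ∀ ξ, ∫ η, L η ξ ∂Post = -G)
    (hL1 : ∀ᵐ η ∂Post, ∫⁻ ξ, ENNReal.ofReal (Real.exp (L η ξ)) ∂P = 1) :
    ∫⁻ η, klDiv Q (P.withDensity fun ξ => ENNReal.ofReal (Real.exp (L η ξ))) ∂Post =
      klDiv Q P + ENNReal.ofReal G := by
  set q : Ξ → ℝ := fun ξ => (Q.rnDeriv P ξ).toReal with hq
  have hqm : Measurable q := by fun_prop
  have hq0 : ∀ ξ, 0 ≤ q ξ := fun ξ => ENNReal.toReal_nonneg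
  have hLη : ∀ η, Measurable (L η) := fun η => hL.comp measurable_prodMk_left
  have hexpm : Measurable fun p : E × Ξ => ENNReal.ofReal (Real.exp (L p.1 p.2)) :=
    (Real.measurable_exp.comp hL).ennreal_ofReal
  have hDm : Measurable fun p : E × Ξ =>
      klFun (q p.2) - q p.2 * L p.1 p.2 + Real.exp (L p.1 p.2) - 1 := by
    have h1 : Measurable fun p : E × Ξ => q p.2 := hqm.comp measurable_snd
    have h2 : Measurable fun p : E × Ξ => L p.1 p.2 := hL
    exact (((measurable_klFun.comp h1).sub (h1.mul h2)).add h2.exp).sub_const 1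
  have htotal : ∫⁻ ξ, ∫⁻ η, ENNReal.ofReal (Real.exp (L η ξ)) ∂Post ∂P = 1 := by
    rw [← lintegral_lintegral_swap (f := fun η ξ => ENNReal.ofReal (Real.exp (L η ξ)))
      hexpm.aemeasurable, lintegral_congr_ae hL1]
    simp
  have hfin : ∀ᵐ ξ ∂P, ∫⁻ η, ENNReal.ofReal (Real.exp (L η ξ)) ∂Post < ∞ :=
    ae_lt_top hexpm.lintegral_prod_left' (by rw [htotal]; simp)
  -- Moving the `1` to the left avoids subtraction in `ℝ≥0∞`; after integration over `P` it cancels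
  -- against `htotal`.
  have hpoint : ∀ᵐ ξ ∂P,
      ∫⁻ η, ENNReal.ofReal (klFun (q ξ) - q ξ * L η ξ + Real.exp (L η ξ) - 1) ∂Post + 1 =
        ENNReal.ofReal (klFun (q ξ)) + ENNReal.ofReal G * ENNReal.ofReal (q ξ) +
          ∫⁻ η, ENNReal.ofReal (Real.exp (L η ξ)) ∂Post := by
    filter_upwards [hfin] with ξ hξ
    have hLξ : Measurable fun η => L η ξ := hL.comp measurable_prodMk_right
    have hexp := integrable_exp_of_lintegral_ne_top hLξ hξ.ne
    have h1 : Integrable (fun η => klFun (q ξ) - q ξ * L η ξ) Post :=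
      (integrable_const _).sub ((hLint ξ).const_mul _)
    have h2 : Integrable (fun η => klFun (q ξ) - q ξ * L η ξ + Real.exp (L η ξ)) Post :=
      h1.add hexp
    have h3 : Integrable (fun η => klFun (q ξ) - q ξ * L η ξ + Real.exp (L η ξ) - 1) Post :=
      h2.sub (integrable_const 1)
    have hnn : ∀ η, 0 ≤ klFun (q ξ) - q ξ * L η ξ + Real.exp (L η ξ) - 1 := fun η => by
      have := mul_le_klFun_add_exp (hq0 ξ) (L η ξ)
      linarith
    rw [← ofReal_integral_eq_lintegral_ofReal h3 (Filter.Eventually.of_forall hnn),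
      ← ofReal_integral_eq_lintegral_ofReal hexp
        (Filter.Eventually.of_forall fun η => (Real.exp_pos _).le),
      ← ENNReal.ofReal_one, ← ENNReal.ofReal_add (integral_nonneg hnn) zero_le_one,
      ← ENNReal.ofReal_mul hG, ← ENNReal.ofReal_add (klFun_nonneg (hq0 ξ))
        (mul_nonneg hG (hq0 ξ)), ← ENNReal.ofReal_add (add_nonneg (klFun_nonneg (hq0 ξ))
        (mul_nonneg hG (hq0 ξ))) (integral_nonneg fun η => (Real.exp_pos _).le),
      integral_sub h2 (integrable_const 1), integral_add h1 hexp,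
      integral_sub (integrable_const _) ((hLint ξ).const_mul _), integral_const_mul, hLG]
    congr 1
    simp
    ring
  have hkl : ∀ᵐ η ∂Post, klDiv Q (P.withDensity fun ξ => ENNReal.ofReal (Real.exp (L η ξ))) =
      ∫⁻ ξ, ENNReal.ofReal (klFun (q ξ) - q ξ * L η ξ + Real.exp (L η ξ) - 1) ∂P := by
    filter_upwards [hL1] with η hη
    have : IsFiniteMeasure (P.withDensity fun ξ => ENNReal.ofReal (Real.exp (L η ξ))) :=
      isFiniteMeasure_withDensity (by rw [hη]; simp)
    exact klDiv_withDensity_exp hac (hLη η)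
  rw [lintegral_congr_ae hkl, lintegral_lintegral_swap
    (f := fun η ξ => ENNReal.ofReal (klFun (q ξ) - q ξ * L η ξ + Real.exp (L η ξ) - 1))
    hDm.ennreal_ofReal.aemeasurable]
  have hqint : ∫⁻ ξ, ENNReal.ofReal (q ξ) ∂P = 1 := by
    rw [← measure_univ (μ := Q), ← Measure.lintegral_rnDeriv hac]
    refine lintegral_congr_ae ?_
    filter_upwards [Q.rnDeriv_ne_top P] with ξ hξ
    exact ENNReal.ofReal_toReal hξ
  have hsum := lintegral_congr_ae hpoint
  rw [lintegral_add_right _ measurable_const, lintegral_add_right _ hexpm.lintegral_prod_left',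
    htotal, lintegral_add_left (by fun_prop), lintegral_const_mul _ (by fun_prop), hqint, mul_one,
    ← klDiv_eq_lintegral_klFun_of_ac hac] at hsum
  simpa using hsum

end AverageKL

/-- Applied to the conjugate density as a function of one hyperparameter coordinate; both signs are
needed to control exponential moments of both signs. -/
theorem ContinuousAt.exists_pos_ne_zero {φ : ℝ → ℝ} {a : ℝ} (hφ : ContinuousAt φ a)
    (ha : φ a ≠ 0) : ∃ δ : ℝ, 0 < δ ∧ φ (a + δ) ≠ 0 ∧ φ (a - δ) ≠ 0 := by
  obtain ⟨r, hr, hball⟩ := Metric.eventually_nhds_iff.1 (hφ.eventually_ne ha)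
  refine ⟨r / 2, by positivity, hball ?_, hball ?_⟩ <;>
  · simp [abs_of_pos hr, hr]

theorem integrable_of_integrable_exp_mul {E : Type*} [MeasurableSpace E] {μ : Measure E}
    {Y : E → ℝ} {δ : ℝ} (hδ : 0 < δ) (h1 : Integrable (fun ω => Real.exp (δ * Y ω)) μ)
    (h2 : Integrable (fun ω => Real.exp (-δ * Y ω)) μ) : Integrable Y μ := by
  have := ProbabilityTheory.integrable_pow_of_integrable_exp_mul hδ.ne' h1 h2 1
  simpa using this

/-! ### Exponential families and their likelihoods -/

namespace ExpFamily

variable {Ξ : Type*} [MeasurableSpace Ξ] {K : ℕ} (M : ExpFamily Ξ K)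

instance : SigmaFinite M.base := M.sigmaFinite_base

@[fun_prop]
theorem measurable_logPartition : Measurable M.logPartition := by
  have hs := M.measurable_s
  have hh := M.measurable_h
  have : Measurable fun η => M.partition η :=
    Measurable.lintegral_prod_right (f := fun η ξ =>
      ENNReal.ofReal (M.h ξ * Real.exp (inner ℝ η (M.s ξ)))) (by fun_prop)
  exact this.ennreal_toReal.log

theorem measurableSet_natParam : MeasurableSet M.natParam := by
  have hs := M.measurable_s
  have hh := M.measurable_h
  have : Measurable fun η => M.partition η :=
    Measurable.lintegral_prod_right (f := fun η ξ =>
      ENNReal.ofReal (M.h ξ * Real.exp (inner ℝ η (M.s ξ)))) (by fun_prop)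
  exact measurableSet_lt this measurable_const

theorem measurable_density (η : EuclideanSpace ℝ (Fin K)) (a : ℝ) :
    Measurable fun ξ => ENNReal.ofReal (M.h ξ * Real.exp (inner ℝ η (M.s ξ) - a)) := by
  have hs := M.measurable_s
  have hh := M.measurable_h
  fun_prop

theorem partition_ne_zero (η : EuclideanSpace ℝ (Fin K)) : M.partition η ≠ 0 := by
  have hm := M.measurable_density η 0
  simp only [sub_zero] at hm
  rw [partition, Ne, lintegral_eq_zero_iff hm]
  refine fun h => M.h_ne_zero ?_
  filter_upwards [h] with ξ hξ
  simp only [Pi.zero_apply, ENNReal.ofReal_eq_zero] at hξ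
  exact le_antisymm (nonpos_of_mul_nonpos_left hξ (Real.exp_pos _)) (M.h_nonneg ξ)

theorem exp_logPartition {η : EuclideanSpace ℝ (Fin K)} (hη : η ∈ M.natParam) :
    ENNReal.ofReal (Real.exp (M.logPartition η)) = M.partition η := by
  rw [logPartition, Real.exp_log (ENNReal.toReal_pos (M.partition_ne_zero η) hη.ne),
    ENNReal.ofReal_toReal hη.ne]

theorem lintegral_density (η : EuclideanSpace ℝ (Fin K)) (a : ℝ) :
    ∫⁻ ξ, ENNReal.ofReal (M.h ξ * Real.exp (inner ℝ η (M.s ξ) - a)) ∂M.base =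
      ENNReal.ofReal (Real.exp (-a)) * M.partition η := by
  have hm := M.measurable_density η 0
  simp only [sub_zero] at hm
  rw [partition, ← lintegral_const_mul _ hm]
  refine lintegral_congr fun ξ => ?_
  rw [← ENNReal.ofReal_mul (Real.exp_pos _).le, sub_eq_add_neg, Real.exp_add]
  congr 1
  ring

theorem lintegral_density_logPartition {η : EuclideanSpace ℝ (Fin K)} (hη : η ∈ M.natParam) :
    ∫⁻ ξ, ENNReal.ofReal (M.h ξ * Real.exp (inner ℝ η (M.s ξ) - M.logPartition η)) ∂M.base
      = 1 := by
  rw [lintegral_density, ← M.exp_logPartition hη, ← ENNReal.ofReal_mul (Real.exp_pos _).le,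
    ← Real.exp_add, neg_add_cancel, Real.exp_zero, ENNReal.ofReal_one]

theorem isProbabilityMeasure_likelihood {η : EuclideanSpace ℝ (Fin K)} (hη : η ∈ M.natParam) :
    IsProbabilityMeasure (M.likelihood η) := by
  constructor
  rw [likelihood, withDensity_apply _ MeasurableSet.univ, Measure.restrict_univ,
    M.lintegral_density_logPartition hη]

/-- The log-likelihood ratio between two parameters. -/
noncomputable def logRatio (η' η : EuclideanSpace ℝ (Fin K)) (ξ : Ξ) : ℝ :=
  inner ℝ (η - η') (M.s ξ) - M.logPartition η + M.logPartition η'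

theorem measurable_logRatio (η' : EuclideanSpace ℝ (Fin K)) :
    Measurable (Function.uncurry (M.logRatio η')) := by
  have hs := M.measurable_s
  have h1 : Measurable fun p : EuclideanSpace ℝ (Fin K) × Ξ =>
      inner ℝ (p.1 - η') (M.s p.2) - M.logPartition p.1 + M.logPartition η' := by fun_prop
  exact h1

theorem likelihood_eq_withDensity (η' η : EuclideanSpace ℝ (Fin K)) :
    M.likelihood η =
      (M.likelihood η').withDensity fun ξ => ENNReal.ofReal (Real.exp (M.logRatio η' η ξ)) := by
  have hm : Measurable fun ξ => ENNReal.ofReal (Real.exp (M.logRatio η' η ξ)) :=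
    ((M.measurable_logRatio η').comp measurable_prodMk_left).exp.ennreal_ofReal
  rw [likelihood, likelihood, ← withDensity_mul _ (M.measurable_density _ _) hm]
  congr 1
  ext ξ
  rw [Pi.mul_apply, ← ENNReal.ofReal_mul (mul_nonneg (M.h_nonneg ξ) (Real.exp_pos _).le),
    mul_assoc, ← Real.exp_add, logRatio, inner_sub_left]
  ring_nf

/-- The ratio is an exponential, so it never vanishes. Absolute continuity with respect to one
likelihood therefore gives it for all. -/
theorem likelihood_absolutelyContinuous (η' η : EuclideanSpace ℝ (Fin K)) :
    M.likelihood η' ≪ M.likelihood η := by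
  rw [M.likelihood_eq_withDensity η' η]
  refine withDensity_absolutelyContinuous'
    ((M.measurable_logRatio η').comp measurable_prodMk_left).exp.ennreal_ofReal.aemeasurable
    (Filter.Eventually.of_forall fun ξ => ?_)
  simpa using Real.exp_pos _

/-! ### The conjugate distribution: moments, Jensen and the ambiguity set -/

variable {τ : EuclideanSpace ℝ (Fin K)} {ν : ℝ}

@[fun_prop]
theorem measurable_conjPDF : Measurable (M.conjPDF τ ν) := by
  unfold conjPDF
  fun_prop

theorem ae_conj_mem_natParam : ∀ᵐ η ∂M.conj τ ν, η ∈ M.natParam :=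
  (withDensity_absolutelyContinuous _ _).ae_le (ae_restrict_mem M.measurableSet_natParam)

/-- Tilting a conjugate density exponentially shifts its hyperparameters, so exponential moments are
ratios of normalising constants. -/
theorem lintegral_exp_conj (hp : (τ, ν) ∈ M.properHyper) (σ : EuclideanSpace ℝ (Fin K)) (δ : ℝ) :
    ∫⁻ η, ENNReal.ofReal (Real.exp (inner ℝ σ η - δ * M.logPartition η)) ∂M.conj τ ν =
      (M.conjZ τ ν)⁻¹ * M.conjZ (τ + σ) (ν + δ) := by
  have hZ : 0 < (M.conjZ τ ν).toReal := ENNReal.toReal_pos hp.1 hp.2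
  rw [conj, lintegral_withDensity_eq_lintegral_mul _ M.measurable_conjPDF.ennreal_ofReal
    (by fun_prop), conjZ.eq_def M (τ + σ), ← lintegral_const_mul _ (by fun_prop)]
  refine lintegral_congr fun η => ?_
  rw [Pi.mul_apply, ← ENNReal.ofReal_toReal hp.2, ← ENNReal.ofReal_inv_of_pos hZ,
    ← ENNReal.ofReal_mul (by unfold conjPDF; positivity), ← ENNReal.ofReal_mul (by positivity),
    conjPDF, div_mul_eq_mul_div, ← Real.exp_add, div_eq_inv_mul, inner_add_left]
  ring_nf

theorem isProbabilityMeasure_conj (hp : (τ, ν) ∈ M.properHyper) :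
    IsProbabilityMeasure (M.conj τ ν) := by
  have h := M.lintegral_exp_conj hp 0 0
  simp only [inner_zero_left, zero_mul, sub_zero, Real.exp_zero, ENNReal.ofReal_one, add_zero,
    lintegral_const, one_mul] at h
  exact ⟨h.trans (ENNReal.inv_mul_cancel hp.1 hp.2)⟩

theorem integrable_exp_conj (hp : (τ, ν) ∈ M.properHyper) (σ : EuclideanSpace ℝ (Fin K)) (δ : ℝ)
    (hfin : M.conjZ (τ + σ) (ν + δ) ≠ ∞) :
    Integrable (fun η => Real.exp (inner ℝ σ η - δ * M.logPartition η)) (M.conj τ ν) := by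
  refine integrable_exp_of_lintegral_ne_top (by fun_prop) ?_
  rw [M.lintegral_exp_conj hp]
  exact ENNReal.mul_ne_top (ENNReal.inv_ne_top.2 hp.1) hfin

theorem conjPDF_ne_zero (hp : (τ, ν) ∈ M.properHyper) (η : EuclideanSpace ℝ (Fin K)) :
    M.conjPDF τ ν η ≠ 0 :=
  div_ne_zero (Real.exp_pos _).ne' (ENNReal.toReal_pos hp.1 hp.2).ne'

/-- Where `conjZ` is infinite, `toReal` sends it to `0` and division by `0` gives `0`. -/
theorem conjZ_ne_top_of_conjPDF_ne_zero {η : EuclideanSpace ℝ (Fin K)}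
    (h : M.conjPDF τ ν η ≠ 0) : M.conjZ τ ν ≠ ∞ := by
  rintro htop
  simp [conjPDF, htop] at h

/-- Differentiability in `ν` gives continuity, hence a nonzero density and finite `Z` at `ν ± δ`; so
`exp (± δ A)` is integrable, and so is `A`. The same argument along each coordinate of `τ` handles
the mean. -/
theorem integrable_logPartition (hp : (τ, ν) ∈ M.properHyper) {η : EuclideanSpace ℝ (Fin K)}
    (hη : M.HasHyperPartials τ ν η) : Integrable M.logPartition (M.conj τ ν) := by
  obtain ⟨δ, hδ, h1, h2⟩ := hη.1.continuousAt.exists_pos_ne_zero (M.conjPDF_ne_zero hp η)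
  have i1 := M.integrable_exp_conj hp 0 δ
    (by rw [add_zero]; exact M.conjZ_ne_top_of_conjPDF_ne_zero h1)
  have i2 := M.integrable_exp_conj hp 0 (-δ)
    (by rw [add_zero, ← sub_eq_add_neg]; exact M.conjZ_ne_top_of_conjPDF_ne_zero h2)
  refine integrable_of_integrable_exp_mul hδ ?_ ?_
  · simpa using i2
  · simpa using i1

theorem integrable_id_conj (hp : (τ, ν) ∈ M.properHyper) {η : EuclideanSpace ℝ (Fin K)}
    (hη : M.HasHyperPartials τ ν η) : Integrable (fun η => η) (M.conj τ ν) := by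
  refine integrable_piLp_iff.2 fun i => ?_
  have hc : ContinuousAt (fun t : ℝ => M.conjPDF (τ + t • EuclideanSpace.single i 1) ν η) 0 :=
    DifferentiableAt.continuousAt (hη.2 i)
  obtain ⟨δ, hδ, h1, h2⟩ := hc.exists_pos_ne_zero (by simpa using M.conjPDF_ne_zero hp η)
  have i1 := M.integrable_exp_conj hp (δ • EuclideanSpace.single i 1) 0
    (by rw [add_zero]; simpa using M.conjZ_ne_top_of_conjPDF_ne_zero h1)
  have i2 := M.integrable_exp_conj hp ((-δ) • EuclideanSpace.single i 1) 0
    (by rw [add_zero]; simpa using M.conjZ_ne_top_of_conjPDF_ne_zero h2)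
  refine integrable_of_integrable_exp_mul hδ ?_ ?_
  · simpa [inner_smul_left, EuclideanSpace.inner_single_left] using i1
  · simpa [inner_smul_left, EuclideanSpace.inner_single_left] using i2

theorem integral_inner_conj (hid : Integrable (fun η => η) (M.conj τ ν))
    (v : EuclideanSpace ℝ (Fin K)) :
    ∫ η, inner ℝ η v ∂M.conj τ ν = inner ℝ (M.etaHat τ ν) v := by
  simp_rw [real_inner_comm v]
  exact integral_inner hid v

/-- Jensen's inequality for the log-partition function, in multiplicative form. -/
theorem partition_etaHat_le [IsProbabilityMeasure (M.conj τ ν)]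
    (hid : Integrable (fun η => η) (M.conj τ ν))
    (hA : Integrable M.logPartition (M.conj τ ν)) :
    M.partition (M.etaHat τ ν) ≤
      ENNReal.ofReal (Real.exp (∫ η, M.logPartition η ∂M.conj τ ν)) := by
  have hs := M.measurable_s
  have hh := M.measurable_h
  set a := ∫ η, M.logPartition η ∂M.conj τ ν with ha
  -- Jensen is applied to `exp` for each fixed `ξ`, then integrated over `ξ`. Finiteness of the
  -- partition function at `η̂` is thus a conclusion, not a premise.
  have hpoint : ∀ ξ, ENNReal.ofReal (M.h ξ * Real.exp (inner ℝ (M.etaHat τ ν) (M.s ξ) - a)) ≤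
      ∫⁻ η, ENNReal.ofReal (M.h ξ * Real.exp (inner ℝ η (M.s ξ) - M.logPartition η))
        ∂M.conj τ ν := fun ξ => by
    simp_rw [ENNReal.ofReal_mul (M.h_nonneg ξ)]
    rw [lintegral_const_mul _ (by fun_prop)]
    refine mul_le_mul_right ?_ _
    by_cases htop : ∫⁻ η, ENNReal.ofReal (Real.exp (inner ℝ η (M.s ξ) - M.logPartition η))
        ∂M.conj τ ν = ∞
    · rw [htop]; exact le_top
    have hi := integrable_exp_of_lintegral_ne_top (by fun_prop) htop
    rw [← ofReal_integral_eq_lintegral_ofReal hi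
      (Filter.Eventually.of_forall fun η => (Real.exp_pos _).le)]
    refine ENNReal.ofReal_le_ofReal ?_
    have hin : Integrable (fun η => inner ℝ η (M.s ξ)) (M.conj τ ν) := hid.inner_const _
    rw [← M.integral_inner_conj hid, ha, ← integral_sub hin hA]
    exact convexOn_exp.map_integral_le Real.continuous_exp.continuousOn isClosed_univ
      (Filter.Eventually.of_forall fun _ => Set.mem_univ _) (hin.sub hA) hi
  have hone : ENNReal.ofReal (Real.exp (-a)) * M.partition (M.etaHat τ ν) ≤ 1 := by
    rw [← lintegral_density]
    refine (lintegral_mono hpoint).trans ?_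
    rw [lintegral_lintegral_swap (f := fun ξ η =>
      ENNReal.ofReal (M.h ξ * Real.exp (inner ℝ η (M.s ξ) - M.logPartition η)))
      (by fun_prop), lintegral_congr_ae (M.ae_conj_mem_natParam.mono
        fun η hη => M.lintegral_density_logPartition hη)]
    simp
  calc M.partition (M.etaHat τ ν)
      = ENNReal.ofReal (Real.exp a) *
          (ENNReal.ofReal (Real.exp (-a)) * M.partition (M.etaHat τ ν)) := by
        rw [← mul_assoc, ← ENNReal.ofReal_mul (Real.exp_pos _).le, ← Real.exp_add, add_neg_cancel,
          Real.exp_zero, ENNReal.ofReal_one, one_mul]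
    _ ≤ ENNReal.ofReal (Real.exp a) * 1 := mul_le_mul_right hone _
    _ = _ := mul_one _

theorem etaHat_mem_natParam [IsProbabilityMeasure (M.conj τ ν)]
    (hid : Integrable (fun η => η) (M.conj τ ν))
    (hA : Integrable M.logPartition (M.conj τ ν)) :
    M.etaHat τ ν ∈ M.natParam :=
  (M.partition_etaHat_le hid hA).trans_lt ENNReal.ofReal_lt_top

theorem gap_nonneg [IsProbabilityMeasure (M.conj τ ν)]
    (hid : Integrable (fun η => η) (M.conj τ ν))
    (hA : Integrable M.logPartition (M.conj τ ν)) :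
    0 ≤ M.gap τ ν := by
  have h := M.partition_etaHat_le hid hA
  rw [← M.exp_logPartition (M.etaHat_mem_natParam hid hA),
    ENNReal.ofReal_le_ofReal_iff (Real.exp_pos _).le, Real.exp_le_exp] at h
  exact sub_nonneg.2 h

/-- The posterior mean of `logRatio` is `A(η̂) - E[A(η)] = -G` at every `ξ`, because `η - η̂` has
mean zero. -/
theorem lintegral_klDiv_likelihood [IsProbabilityMeasure (M.conj τ ν)]
    (hid : Integrable (fun η => η) (M.conj τ ν))
    (hA : Integrable M.logPartition (M.conj τ ν))
    {Q : Measure Ξ} [IsProbabilityMeasure Q]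
    (hac : Q ≪ M.likelihood (M.etaHat τ ν)) :
    ∫⁻ η, klDiv Q (M.likelihood η) ∂M.conj τ ν =
      klDiv Q (M.likelihood (M.etaHat τ ν)) + ENNReal.ofReal (M.gap τ ν) := by
  have := M.isProbabilityMeasure_likelihood (M.etaHat_mem_natParam hid hA)
  have hin : ∀ ξ, Integrable (fun η => inner ℝ (η - M.etaHat τ ν) (M.s ξ)) (M.conj τ ν) :=
    fun ξ => (hid.sub (integrable_const _)).inner_const _
  rw [lintegral_congr fun η =>
    congrArg (klDiv Q) (M.likelihood_eq_withDensity (M.etaHat τ ν) η)]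
  refine lintegral_klDiv_withDensity_exp hac (M.measurable_logRatio _) (M.gap_nonneg hid hA)
    (fun ξ => ((hin ξ).sub hA).add (integrable_const _)) (fun ξ => ?_) ?_
  · have h1 : Integrable (fun η => inner ℝ (η - M.etaHat τ ν) (M.s ξ) - M.logPartition η)
        (M.conj τ ν) := (hin ξ).sub hA
    simp only [logRatio]
    rw [integral_add h1 (integrable_const _), integral_sub (hin ξ) hA]
    simp only [inner_sub_left]
    rw [integral_sub (hid.inner_const _) (integrable_const _), M.integral_inner_conj hid, gap]
    simp only [integral_const, probReal_univ, one_smul, sub_self]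
    ring
  · filter_upwards [M.ae_conj_mem_natParam] with η hη
    have := M.isProbabilityMeasure_likelihood hη
    have hu := measure_univ (μ := M.likelihood η)
    rwa [M.likelihood_eq_withDensity (M.etaHat τ ν), withDensity_apply _ MeasurableSet.univ,
      Measure.restrict_univ] at hu

/-- The posterior-expectation ambiguity set is a Kullback-Leibler ball around the likelihood at the
posterior mean. -/
theorem basPE_eq_klBall [IsProbabilityMeasure (M.conj τ ν)]
    (hid : Integrable (fun η => η) (M.conj τ ν))
    (hA : Integrable M.logPartition (M.conj τ ν))
    (ε : ℝ≥0) (hε : M.gap τ ν ≤ ε) :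
    basPE M.natParam M.likelihood (M.conj τ ν) ε =
      {Q : ProbabilityMeasure Ξ | klDiv (Q : Measure Ξ) (M.likelihood (M.etaHat τ ν)) ≤
        ENNReal.ofReal (ε - M.gap τ ν)} := by
  have hG := M.gap_nonneg hid hA
  have hiff : ∀ Q : ProbabilityMeasure Ξ, (Q : Measure Ξ) ≪ M.likelihood (M.etaHat τ ν) →
      (∫⁻ η, klDiv (Q : Measure Ξ) (M.likelihood η) ∂M.conj τ ν ≤ ε ↔
        klDiv (Q : Measure Ξ) (M.likelihood (M.etaHat τ ν)) ≤
          ENNReal.ofReal (ε - M.gap τ ν)) := fun Q hac => by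
    rw [M.lintegral_klDiv_likelihood hid hA hac, ENNReal.ofReal_sub _ hG,
      ENNReal.ofReal_coe_nnreal, ENNReal.le_sub_iff_add_le_right ENNReal.ofReal_ne_top
        ((ENNReal.ofReal_le_ofReal hε).trans_eq ENNReal.ofReal_coe_nnreal)]
  ext Q
  constructor
  · rintro ⟨hac, hle⟩
    exact (hiff Q (hac _ (M.etaHat_mem_natParam hid hA))).1 hle
  · intro hle
    -- Finite divergence already forces absolute continuity, so the ball needs no separate
    -- condition.
    have hac := (klDiv_ne_top_iff.1 (ne_top_of_le_ne_top ENNReal.ofReal_ne_top hle)).1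
    exact ⟨fun η _ => hac.trans (M.likelihood_absolutelyContinuous _ _), (hiff Q hac).2 hle⟩

end ExpFamily

/-! ### The duality theorem -/

theorem theorem1 {Ξ : Type*} [MeasurableSpace Ξ] {K : ℕ} (M : ExpFamily Ξ K)
    {X : Type*} (f : X → Ξ → ℝ) (hf : ∀ x, Measurable (f x))
    -- the hyperparameter space, and differentiability of the conjugate density on it
    (T : Set (EuclideanSpace ℝ (Fin K) × ℝ)) (hT : T ⊆ M.properHyper)
    (hdiff : ∀ᵐ η ∂(volume.restrict M.natParam), ∀ p ∈ T, M.HasHyperPartials p.1 p.2 η)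
    -- prior hyperparameters, data, and the posterior hyperparameters
    (τ₀ : EuclideanSpace ℝ (Fin K)) (ν₀ : ℝ) (n : ℕ) (data : Fin n → Ξ)
    (τ : EuclideanSpace ℝ (Fin K)) (hτ : τ = τ₀ + ∑ i, M.s (data i))
    (ν : ℝ) (hν : ν = ν₀ + n) (hpost : (τ, ν) ∈ T)
    (ε : ℝ≥0) (hε : M.gap τ ν ≤ (ε : ℝ))
    (hmgf : FiniteMGF (M.likelihood (M.etaHat τ ν)) f) :
    -- the posterior mean and the gap are well defined
    Integrable (fun η => η) (M.conj τ ν) ∧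
    Integrable M.logPartition (M.conj τ ν) ∧
    M.etaHat τ ν ∈ M.natParam ∧
    -- strong duality
    ∀ x, worstCaseRisk (basPE M.natParam M.likelihood (M.conj τ ν) ε) (f x) =
      ⨅ γ : ℝ≥0, ((((γ : ℝ) * ((ε : ℝ) - M.gap τ ν) : ℝ)) : EReal) +
        scaledLogMGF (M.likelihood (M.etaHat τ ν)) (f x) γ := by
  have hp : (τ, ν) ∈ M.properHyper := hT hpost
  -- `Z ≠ 0` forces `Ω` to have positive volume, so the almost-everywhere hypothesis holds at some
  -- `η`. One such point suffices, since it is used only to show that `Z` is finite nearby.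
  have hne : (ae (volume.restrict M.natParam)).NeBot := by
    rw [ae_neBot]
    intro h
    exact hp.1 (by simp [ExpFamily.conjZ, h])
  obtain ⟨η, hη⟩ := hdiff.exists
  have hη : M.HasHyperPartials τ ν η := hη _ hpost
  have hid := M.integrable_id_conj hp hη
  have hA := M.integrable_logPartition hp hη
  have := M.isProbabilityMeasure_conj hp
  have hmem := M.etaHat_mem_natParam hid hA
  have := M.isProbabilityMeasure_likelihood hmem
  refine ⟨hid, hA, hmem, fun x => ?_⟩
  rw [M.basPE_eq_klBall hid hA ε hε]
  exact worstCaseRisk_klBall (hf x) (hmgf x) (sub_nonneg.2 hε)
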